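/- **Theorem 8.5.** *Multipoles.* A (cubic) multipole is a finite cubic multigraph in which edge ends are allowed to be free; free ends are called semiedges. A $(2,2)$-pole has four semiedges split into an input and an output connector of size two; a $(2,2;1)$-pole has one further, residual semiedge. A junction of two semiedges identifies these free ends, merging the two edges into one. The join $D\circ B$ is obtained by joining the output connector of $D$ to the input connector of $B$ (in any order). *Tetrahedral flows.* Let $T$ be a tetrahedron in $PG(3,2)$ with corner points $p_1,\dots,p_4$ (a basis of $\mathbb F_2^4$): its ten points are the corners $p_i$ and the midpoints $p_i+p_j$ $(i\ne j)$, and its six lines are $\{p_i,p_i+p_j,p_j\}$. A $T$-flow on a multipole assigns a point of $T$ to each edge so that the values on the three edge ends at each vertex form a line of $T$. A $(2,2)$-pole $X$ has a transition $\{x,y\}\to\{x',y'\}$ if some $T$-flow on $X$ takes the values $x,y$ on the input semiedges and $x',y'$ on the output semiedges. Each pair of (possibly equal) points of $T$ has exactly one of the following shapes, where $c_1,c_2,c_3,c_4$ denote distinct corners: line segment $\mathtt{ls}$: $\{c_1,c_2\}$; half-line $\mathtt{hl}$: $\{c_1,c_1+c_2\}$; angle $\mathtt{ang}$: $\{c_1+c_2,c_1+c_3\}$;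 altitude $\mathtt{alt}$: $\{c_1,c_2+c_3\}$; axis $\mathtt{ax}$: $\{c_1+c_2,c_3+c_4\}$; double point $\mathtt{dpt}$: $\{x,x\}$. A transition is stationary if both its pairs have the same shape. A decollineator is a $(2,2)$-pole with no transition $\{x,y\}\to\{x',y'\}$ such that $x\neq y$, $x'\ne y'$, $\{x,y\}$ lies on a line of $T$, and $\{x',y'\}$ lies on a line of $T$. A bipartite $(2,2;1)$-pole is obtained from a bipartite cubic graph by removing a path $uwv$ of length two; the semiedges formerly incident with $u$, $v$ and $w$ form the input connector, the output connector and the residual semiedge, respectively. *Halin snarks.* Let $H=C\cup S$ be a cubic Halin graph: $S$ is a plane tree with at least one trivalent vertex all of whose vertices are of degree $1$ or $3$, and $C=v_0v_1\cdots v_{k-1}$ is a circuit passing through the leaves of $S$ in the cyclic order in which they occur around $S$ (so $k\ge3$). For each $i$ let $F_i=D_i\circ B_i$ (a Halin fragment), where $D_i$ is a decollineator and $B_i$ is a bipartite $(2,2;1)$-pole. The Halin snark $H^\sharp$ is obtained by joining the output connector of $F_i$ to the input connector of $F_{i+1}$ for every $i$ modulo $k$, adding $S-\{v_0,\dots,v_{k-1}\}$,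 and attaching the residual semiedge of each $F_i$ to the neighbour of $v_i$ in $S$. An extended Halin $(2,2)$-pole $Z$ is obtained from $H^\sharp$ by severing, for some $s$, the two edges that connect the output connector of $F_{s-1}$ to the input connector of $F_s$; the input connector of $Z$ is that of $F_s$ and the output connector of $Z$ is that of $F_{s-1}$. *Claim.* For every extended Halin $(2,2)$-pole $Z$, every transition through $Z$ has the form $\mathtt{ang}\to\mathtt{ls}$; that is, if $\{x,y\}\to\{x',y'\}$ is a transition through $Z$, then $\{x,y\}$ is an angle and $\{x',y'\}$ is a line segment. In particular, $Z$ admits no stationary transition. -/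

import Mathlib

namespace HalinSnarks

/-! ## Multipoles -/

/-- A finite cubic multipole whose semiedges (free edge ends) are named by `L`; loops and parallel
edges are allowed. Every vertex `v` carries three edge ends `(v, 0), (v, 1), (v, 2)`, the remaining
edge ends are the free ends `l : L`. The map `opp` sends an edge end to the other end of the same
edge, so an edge is a pair `{e, opp e}`; an edge may have no, one or two free ends.
With `L = Empty` this is a finite cubic (multi)graph. -/
structure Pole (L : Type) where
  V : Type
  finite_V : Finite V
  opp : (V × Fin 3) ⊕ L → (V × Fin 3) ⊕ L
  opp_opp : ∀ e, opp (opp e) = e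
  opp_ne : ∀ e, opp e ≠ e

namespace Pole

variable {L L' : Type}

/-- The edge ends of a multipole. -/
abbrev End (M : Pole L) : Type := (M.V × Fin 3) ⊕ L

/-- The vertex incident with an edge end; a free end is incident with no vertex. -/
def vert (M : Pole L) : M.End → Option M.V
  | .inl (v, _) => some v
  | .inr _ => none

/-- Disjoint union of two multipoles: inclusions of edge ends. -/
def sumL (M : Pole L) (N : Pole L') : M.End → ((M.V ⊕ N.V) × Fin 3) ⊕ (L ⊕ L') :=
  Sum.map (Prod.map Sum.inl id) Sum.inl

def sumR (M : Pole L) (N : Pole L') : N.End → ((M.V ⊕ N.V) × Fin 3) ⊕ (L ⊕ L') :=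
  Sum.map (Prod.map Sum.inr id) Sum.inr

/-- Disjoint union of two multipoles. -/
def sum (M : Pole L) (N : Pole L') : Pole (L ⊕ L') where
  V := M.V ⊕ N.V
  finite_V := by
    have := M.finite_V
    have := N.finite_V
    infer_instance
  opp
    | .inl (.inl v, i) => M.sumL N (M.opp (.inl (v, i)))
    | .inl (.inr v, i) => M.sumR N (N.opp (.inl (v, i)))
    | .inr (.inl l) => M.sumL N (M.opp (.inr l))
    | .inr (.inr l) => M.sumR N (N.opp (.inr l))
  opp_opp := by
    rintro (⟨v | v, i⟩ | l | l)
    · have h := M.opp_opp (.inl (v, i))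
      rcases hx : M.opp (.inl (v, i)) with ⟨w, j⟩ | l <;> rw [hx] at h <;> simp [sumL, hx, h]
    · have h := N.opp_opp (.inl (v, i))
      rcases hx : N.opp (.inl (v, i)) with ⟨w, j⟩ | l <;> rw [hx] at h <;> simp [sumR, hx, h]
    · have h := M.opp_opp (.inr l)
      rcases hx : M.opp (.inr l) with ⟨w, j⟩ | l <;> rw [hx] at h <;> simp [sumL, hx, h]
    · have h := N.opp_opp (.inr l)
      rcases hx : N.opp (.inr l) with ⟨w, j⟩ | l <;> rw [hx] at h <;> simp [sumR, hx, h]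
  opp_ne := by
    rintro (⟨v | v, i⟩ | l | l)
    · have h := M.opp_ne (.inl (v, i))
      rcases hx : M.opp (.inl (v, i)) with ⟨w, j⟩ | l <;> rw [hx] at h <;> simp_all [sumL]
    · have h := N.opp_ne (.inl (v, i))
      rcases hx : N.opp (.inl (v, i)) with ⟨w, j⟩ | l <;> rw [hx] at h <;> simp_all [sumR]
    · have h := M.opp_ne (.inr l)
      rcases hx : M.opp (.inr l) with ⟨w, j⟩ | l <;> rw [hx] at h <;> simp_all [sumL]
    · have h := N.opp_ne (.inr l)
      rcases hx : N.opp (.inr l) with ⟨w, j⟩ | l <;> rw [hx] at h <;> simp_all [sumR]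

/-- Disjoint union of a finite family of multipoles: inclusion of edge ends. -/
def sigmaIn {I : Type} (M : I → Pole L) (i : I) :
    (M i).End → ((Σ i, (M i).V) × Fin 3) ⊕ (I × L) :=
  Sum.map (Prod.map (fun v => ⟨i, v⟩) id) (fun l => (i, l))

/-- Disjoint union of a finite family of multipoles; its semiedge `(i, l)` is the semiedge `l` of
the `i`-th member. -/
def sigma {I : Type} [Finite I] (M : I → Pole L) : Pole (I × L) where
  V := Σ i, (M i).V
  finite_V := by
    have := fun i => (M i).finite_V
    infer_instance
  opp
    | .inl (⟨i, v⟩, j) => sigmaIn M i ((M i).opp (.inl (v, j)))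
    | .inr (i, l) => sigmaIn M i ((M i).opp (.inr l))
  opp_opp := by
    rintro (⟨⟨i, v⟩, j⟩ | ⟨i, l⟩)
    · have h := (M i).opp_opp (.inl (v, j))
      rcases hx : (M i).opp (.inl (v, j)) with ⟨w, j'⟩ | l <;> rw [hx] at h <;>
        simp [sigmaIn, hx, h]
    · have h := (M i).opp_opp (.inr l)
      rcases hx : (M i).opp (.inr l) with ⟨w, j'⟩ | l <;> rw [hx] at h <;>
        simp [sigmaIn, hx, h]
  opp_ne := by
    rintro (⟨⟨i, v⟩, j⟩ | ⟨i, l⟩)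
    · have h := (M i).opp_ne (.inl (v, j))
      rcases hx : (M i).opp (.inl (v, j)) with ⟨w, j'⟩ | l <;> rw [hx] at h <;>
        simp_all [sigmaIn]
    · have h := (M i).opp_ne (.inr l)
      rcases hx : (M i).opp (.inr l) with ⟨w, j'⟩ | l <;> rw [hx] at h <;>
        simp_all [sigmaIn]

end Pole

/-! ## Junctions -/

/-- Instructions for performing junctions on a multipole with semiedges `L`: the free end `l` is
to be joined to the free end `mate l` if `mate l ≠ l`, and stays free if `mate l = l`.
The free ends that stay free receive new names from `L'` through `keep`. -/
structure Junctions (L L' : Type) where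
  mate : L → L
  mate_mate : ∀ l, mate (mate l) = l
  keep : L' → L
  keep_injective : Function.Injective keep
  mate_eq_iff : ∀ l, mate l = l ↔ ∃ l', keep l' = l

namespace Pole

variable {L L' : Type}

/-- From an edge end cross the junction there (if there is one), then traverse the next edge. -/
def jump (M : Pole L) (J : Junctions L L') (e : M.End) : M.End :=
  M.opp (Sum.map id J.mate e)

theorem exists_jump_fixed (M : Pole L) (J : Junctions L L') [Finite L]
    (e : (M.V × Fin 3) ⊕ L') :
    ∃ n : ℕ, Sum.map id J.mate ((M.jump J)^[n] (M.opp (Sum.map id J.keep e))) =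
      (M.jump J)^[n] (M.opp (Sum.map id J.keep e)) := by
  have := M.finite_V
  have hm : ∀ x : M.End, Sum.map id J.mate (Sum.map id J.mate x) = x := by
    rintro (x | x) <;> simp [J.mate_mate]
  have hinj : Function.Injective (M.jump J) := by
    intro x y hxy
    have h1 := congrArg M.opp hxy
    simp only [jump, M.opp_opp] at h1
    have h2 := congrArg (Sum.map id J.mate) h1
    rwa [hm, hm] at h2
  have hk : Sum.map id J.mate (Sum.map id J.keep e : M.End) = Sum.map id J.keep e := by
    rcases e with e | l
    · rfl
    · simp [(J.mate_eq_iff (J.keep l)).2 ⟨l, rfl⟩]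
  obtain ⟨n, hn, hp⟩ := Function.mem_periodicPts.1
    (hinj.mem_periodicPts (Sum.map id J.keep e : M.End))
  obtain ⟨m, rfl⟩ : ∃ m, n = m + 1 := ⟨n - 1, (Nat.sub_add_cancel hn).symm⟩
  refine ⟨m, ?_⟩
  have h0 : M.jump J (Sum.map id J.keep e) = M.opp (Sum.map id J.keep e) := by
    rw [jump, hk]
  have h1 : (M.jump J)^[m] (M.opp (Sum.map id J.keep e)) = Sum.map id J.keep e := by
    have := hp.eq
    rwa [Function.iterate_succ_apply, h0] at this
  rw [h1, hk]

open Classical in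
/-- The number of junctions on the edge that starts at `e` once the junctions are performed. -/
noncomputable def runLength (M : Pole L) (J : Junctions L L') [Finite L]
    (e : (M.V × Fin 3) ⊕ L') : ℕ :=
  Nat.find (M.exists_jump_fixed J e)

/-- The other end of the edge that starts at `e` once the junctions are performed: leave `e` along
its edge and go on through junctions until an end is met that is not joined to anything. -/
noncomputable def run (M : Pole L) (J : Junctions L L') [Finite L]
    (e : (M.V × Fin 3) ⊕ L') : M.End :=
  (M.jump J)^[M.runLength J e] (M.opp (Sum.map id J.keep e))

theorem run_mem (M : Pole L) (J : Junctions L L') [Finite L] (e : (M.V × Fin 3) ⊕ L') :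
    ∃ e' : (M.V × Fin 3) ⊕ L', Sum.map id J.keep e' = M.run J e := by
  classical
  have h : Sum.map id J.mate (M.run J e) = M.run J e := Nat.find_spec (M.exists_jump_fixed J e)
  rcases hx : M.run J e with x | l
  · exact ⟨.inl x, rfl⟩
  · rw [hx] at h
    obtain ⟨l', hl'⟩ := (J.mate_eq_iff l).1 (by simpa using h)
    exact ⟨.inr l', by simp [hl']⟩

/-- The edge end reached by `run`, as an edge end of the new multipole. -/
noncomputable def glueOpp (M : Pole L) (J : Junctions L L') [Finite L]
    (e : (M.V × Fin 3) ⊕ L') : (M.V × Fin 3) ⊕ L' :=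
  (M.run_mem J e).choose

theorem keep_glueOpp (M : Pole L) (J : Junctions L L') [Finite L] (e : (M.V × Fin 3) ⊕ L') :
    Sum.map id J.keep (M.glueOpp J e) = M.run J e :=
  (M.run_mem J e).choose_spec

theorem jump_back (M : Pole L) (J : Junctions L L') [Finite L] (e : (M.V × Fin 3) ⊕ L')
    (m n : ℕ) (h : m + n = M.runLength J e) :
    (M.jump J)^[m] (M.opp (M.run J e)) =
      M.opp ((M.jump J)^[n] (M.opp (Sum.map id J.keep e))) := by
  induction m generalizing n with
  | zero =>
    obtain rfl : n = M.runLength J e := by omega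
    rfl
  | succ m ih =>
    rw [Function.iterate_succ_apply', ih (n + 1) (by omega), Function.iterate_succ_apply']
    have hm : ∀ x : M.End, Sum.map id J.mate (Sum.map id J.mate x) = x := by
      rintro (x | x) <;> simp [J.mate_mate]
    simp only [jump, M.opp_opp, hm]

theorem glueOpp_glueOpp (M : Pole L) (J : Junctions L L') [Finite L]
    (e : (M.V × Fin 3) ⊕ L') : M.glueOpp J (M.glueOpp J e) = e := by
  classical
  have hk : ∀ x : (M.V × Fin 3) ⊕ L',
      Sum.map id J.mate (Sum.map id J.keep x : M.End) = Sum.map id J.keep x := by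
    rintro (x | l)
    · rfl
    · simp [(J.mate_eq_iff (J.keep l)).2 ⟨l, rfl⟩]
  have hinj : Function.Injective (Sum.map id J.keep : (M.V × Fin 3) ⊕ L' → M.End) :=
    Function.Injective.sumMap Function.injective_id J.keep_injective
  have hlen : M.runLength J (M.glueOpp J e) = M.runLength J e := by
    rw [runLength, Nat.find_eq_iff]
    constructor
    · rw [keep_glueOpp, jump_back M J e _ 0 (by simp)]
      simp [M.opp_opp, hk]
    · intro m hm
      obtain ⟨n, hn⟩ : ∃ n, m + (n + 1) = M.runLength J e :=
        ⟨M.runLength J e - m - 1, by omega⟩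
      rw [keep_glueOpp, jump_back M J e m (n + 1) hn, Function.iterate_succ_apply']
      have hlt : n < Nat.find (M.exists_jump_fixed J e) := by
        have : M.runLength J e = Nat.find (M.exists_jump_fixed J e) := rfl
        omega
      have hmm : ∀ x : M.End, Sum.map id J.mate (Sum.map id J.mate x) = x := by
        rintro (x | x) <;> simp [J.mate_mate]
      have := Nat.find_min (M.exists_jump_fixed J e) hlt
      simp only [jump, M.opp_opp, hmm] at this ⊢
      exact fun h => this h.symm
  apply hinj
  rw [keep_glueOpp, run, hlen, keep_glueOpp, jump_back M J e _ 0 (by simp)]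
  simp [M.opp_opp]

theorem glueOpp_ne (M : Pole L) (J : Junctions L L') [Finite L]
    (e : (M.V × Fin 3) ⊕ L') : M.glueOpp J e ≠ e := by
  classical
  intro heq
  have hrun : M.run J e = Sum.map id J.keep e := by rw [← keep_glueOpp, heq]
  have hback := M.jump_back J e
  rw [hrun] at hback
  obtain ⟨m, hm | hm⟩ := Nat.even_or_odd' (M.runLength J e)
  · exact M.opp_ne _ (hback m m (by omega)).symm
  · have h := hback (m + 1) m (by omega)
    rw [Function.iterate_succ_apply'] at h
    have hlt : m < Nat.find (M.exists_jump_fixed J e) := by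
      have : M.runLength J e = Nat.find (M.exists_jump_fixed J e) := rfl
      omega
    have h' := congrArg M.opp h
    simp only [jump, M.opp_opp] at h'
    exact Nat.find_min (M.exists_jump_fixed J e) hlt h'

/-- The multipole obtained from `M` by performing the junctions `J`. (Should a chain of edges
without vertices close up on itself, the resulting vertexless circle is discarded; this does not
occur in the constructions below.) -/
noncomputable def glue (M : Pole L) (J : Junctions L L') [Finite L] : Pole L' where
  V := M.V
  finite_V := M.finite_V
  opp := M.glueOpp J
  opp_opp := M.glueOpp_glueOpp J
  opp_ne := M.glueOpp_ne J

end Pole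
/-! ## Dipoles, joins, fragments -/

/-- Names of the semiedges of a `(2,2)`-pole: input connector and output connector. -/
inductive Semi22 : Type
  | inp (j : Fin 2)
  | out (j : Fin 2)

/-- Names of the semiedges of a `(2,2;1)`-pole: input and output connector, and the residual
semiedge. -/
inductive Semi221 : Type
  | inp (j : Fin 2)
  | out (j : Fin 2)
  | res

instance : Finite Semi22 :=
  Finite.of_injective
    (fun l : Semi22 => match l with
      | .inp j => (Sum.inl j : Fin 2 ⊕ Fin 2)
      | .out j => Sum.inr j)
    (by rintro (a | a) (b | b) <;> simp)

instance : Finite Semi221 :=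
  Finite.of_injective
    (fun l : Semi221 => match l with
      | .inp j => (Sum.inl j : Fin 2 ⊕ Option (Fin 2))
      | .out j => Sum.inr (some j)
      | .res => Sum.inr none)
    (by rintro (a | a | _) (b | b | _) <;> simp)

/-- The junctions for the join `D ∘ B`: output connector of `D` to input connector of `B`. -/
def joinJunctions : Junctions (Semi22 ⊕ Semi221) Semi221 where
  mate
    | .inl (.inp j) => .inl (.inp j)
    | .inl (.out j) => .inr (.inp j)
    | .inr (.inp j) => .inl (.out j)
    | .inr (.out j) => .inr (.out j)
    | .inr .res => .inr .res
  mate_mate := by rintro ((j | j) | (j | j | _)) <;> rfl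
  keep
    | .inp j => .inl (.inp j)
    | .out j => .inr (.out j)
    | .res => .inr .res
  keep_injective := by rintro (a | a | _) (b | b | _) <;> simp
  mate_eq_iff := by
    rintro ((j | j) | (j | j | _))
    · exact iff_of_true rfl ⟨.inp j, rfl⟩
    · refine iff_of_false (by simp) ?_
      rintro ⟨a | a | _, h⟩ <;> simp at h
    · refine iff_of_false (by simp) ?_
      rintro ⟨a | a | _, h⟩ <;> simp at h
    · exact iff_of_true rfl ⟨.out j, rfl⟩
    · exact iff_of_true rfl ⟨.res, rfl⟩

/-- The join `D ∘ B` of a `(2,2)`-pole and a `(2,2;1)`-pole. -/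
noncomputable def join (D : Pole Semi22) (B : Pole Semi221) : Pole Semi221 :=
  (D.sum B).glue joinJunctions

/-! ## Tetrahedra and tetrahedral flows -/

/-- Vectors of `𝔽₂⁴`; the nonzero ones are the points of `PG(3,2)`. -/
abbrev Vec : Type := Fin 4 → ZMod 2

/-- A tetrahedron of `PG(3,2)`, given by its four corner points in general position. -/
structure Tetrahedron where
  c : Fin 4 → Vec
  general : LinearIndependent (ZMod 2) c

namespace Tetrahedron

variable (T : Tetrahedron)

/-- The ten points of `T`: corner points and midpoints. -/
def IsPoint (x : Vec) : Prop :=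
  (∃ i, x = T.c i) ∨ ∃ i j, i ≠ j ∧ x = T.c i + T.c j

/-- The six lines of `T`. -/
def IsLine (A : Set Vec) : Prop :=
  ∃ i j, i ≠ j ∧ A = {T.c i, T.c i + T.c j, T.c j}

/-- A pair of distinct points of `T` is collinear if it lies on a line of `T`. -/
def Collinear (P : Sym2 Vec) : Prop :=
  ¬ P.IsDiag ∧ ∃ A, T.IsLine A ∧ ∀ x ∈ P, x ∈ A

end Tetrahedron

/-- The shapes of pairs of points: line segment, half-line, angle, altitude, axis, and double
point (double corner points and double midpoints merged). -/
inductive Shape : Type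
  | ls
  | hl
  | ang
  | alt
  | ax
  | dpt

/-- The pair `P` of points of `T` has the given shape. -/
def Tetrahedron.HasShape (T : Tetrahedron) (P : Sym2 Vec) : Shape → Prop
  | .ls => ∃ i j, i ≠ j ∧ P = s(T.c i, T.c j)
  | .hl => ∃ i j, i ≠ j ∧ P = s(T.c i, T.c i + T.c j)
  | .ang => ∃ i j k, i ≠ j ∧ i ≠ k ∧ j ≠ k ∧ P = s(T.c i + T.c j, T.c i + T.c k)
  | .alt => ∃ i j k, i ≠ j ∧ i ≠ k ∧ j ≠ k ∧ P = s(T.c i, T.c j + T.c k)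
  | .ax => ∃ i j k l, i ≠ j ∧ i ≠ k ∧ i ≠ l ∧ j ≠ k ∧ j ≠ l ∧ k ≠ l ∧
      P = s(T.c i + T.c j, T.c k + T.c l)
  | .dpt => (∃ i, P = s(T.c i, T.c i)) ∨
      ∃ i j, i ≠ j ∧ P = s(T.c i + T.c j, T.c i + T.c j)

/-- A transition `P → Q` is stationary if `P` and `Q` have the same shape. -/
def Tetrahedron.Stationary (T : Tetrahedron) (P Q : Sym2 Vec) : Prop :=
  ∃ σ, T.HasShape P σ ∧ T.HasShape Q σ

namespace Pole

/-- `φ` is a `T`-flow: a valuation of the edges by points of `T` such that the values at the three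
edge ends at each vertex form a line of `T`. -/
def IsFlow {L : Type} (M : Pole L) (T : Tetrahedron) (φ : M.End → Vec) : Prop :=
  (∀ e, φ (M.opp e) = φ e) ∧ (∀ e, T.IsPoint (φ e)) ∧
    ∀ v : M.V, T.IsLine {φ (.inl (v, 0)), φ (.inl (v, 1)), φ (.inl (v, 2))}

/-- `P → Q` is a transition through the `(2,2)`-pole `X`. -/
def HasTransition (X : Pole Semi22) (T : Tetrahedron) (P Q : Sym2 Vec) : Prop :=
  ∃ φ : X.End → Vec, X.IsFlow T φ ∧
    s(φ (.inr (.inp 0)), φ (.inr (.inp 1))) = P ∧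
    s(φ (.inr (.out 0)), φ (.inr (.out 1))) = Q

/-- A decollineator: a `(2,2)`-pole that has no collinear transition. -/
def IsDecollineator (X : Pole Semi22) (T : Tetrahedron) : Prop :=
  ∀ P Q, X.HasTransition T P Q → ¬ (T.Collinear P ∧ T.Collinear Q)

/-- A cubic graph, or a multipole, is bipartite. -/
def IsBipartite {L : Type} (G : Pole L) : Prop :=
  ∃ side : G.V → Bool, ∀ e x y, G.vert e = some x → G.vert (G.opp e) = some y →
    side x ≠ side y

/-- `B` is (isomorphic to) the `(2,2;1)`-pole `G_{uwv}` obtained from the cubic graph `G` by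
removing the path `uwv` of length two, whose edges are `{a, opp a}` joining `u` to `w` and
`{b, opp b}` joining `w` to `v`. All other edges are kept. The semiedges formerly incident with
`u`, `v`, `w` form the input connector, the output connector, and the residual semiedge.
The maps `f` and `j` identify the vertices and edge ends of `B` with those of `G`. -/
structure IsPathRemoval (B : Pole Semi221) (G : Pole Empty) (u w v : G.V) (a b : G.End)
    (f : B.V → G.V) (j : B.End → G.End) : Prop where
  u_ne_w : u ≠ w
  w_ne_v : w ≠ v
  u_ne_v : u ≠ v
  vert_a : G.vert a = some u
  vert_opp_a : G.vert (G.opp a) = some w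
  vert_b : G.vert b = some w
  vert_opp_b : G.vert (G.opp b) = some v
  f_injective : Function.Injective f
  range_f : Set.range f = {u, w, v}ᶜ
  j_injective : Function.Injective j
  range_j : Set.range j = {a, G.opp a, b, G.opp b}ᶜ
  j_opp : ∀ e, j (B.opp e) = G.opp (j e)
  vert_j : ∀ x i, G.vert (j (.inl (x, i))) = some (f x)
  vert_inp : ∀ i, G.vert (j (.inr (.inp i))) = some u
  vert_out : ∀ i, G.vert (j (.inr (.out i))) = some v
  vert_res : G.vert (j (.inr .res)) = some w

/-- A bipartite `(2,2;1)`-pole: one of the form `G_{uwv}` with `G` a bipartite cubic graph. -/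
def IsBipartitePole (B : Pole Semi221) : Prop :=
  ∃ (G : Pole Empty) (u w v : G.V) (a b : G.End) (f : B.V → G.V) (j : B.End → G.End),
    G.IsBipartite ∧ B.IsPathRemoval G u w v a b f j

/-! ## Plane cubic trees and Halin graphs -/

variable {L : Type}

/-- The vertex at which an edge end lies after a new (univalent) vertex has been added at every
free end of `M`. -/
def tip (M : Pole L) : M.End → M.V ⊕ L
  | .inl (v, _) => .inl v
  | .inr l => .inr l

/-- The underlying graph of the multipole `M` with a new univalent vertex at every free end. -/
def graph (M : Pole L) : SimpleGraph (M.V ⊕ L) where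
  Adj x y := x ≠ y ∧ ∃ e, M.tip e = x ∧ M.tip (M.opp e) = y
  symm := by
    constructor
    rintro x y ⟨hne, e, rfl, rfl⟩
    exact ⟨hne.symm, M.opp e, rfl, by rw [M.opp_opp]⟩
  loopless := ⟨fun x h => h.1 rfl⟩

/-- With a new univalent vertex at every free end, `M` is a tree: it has no loops, no parallel
edges, and its underlying graph is a tree. Its leaves are the elements of `L`, all other vertices
are trivalent. -/
structure IsTree (M : Pole L) : Prop where
  no_loop : ∀ e, M.tip (M.opp e) ≠ M.tip e
  no_parallel : ∀ e e', M.tip e = M.tip e' → M.tip (M.opp e) = M.tip (M.opp e') → e = e'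
  isTree : M.graph.IsTree

/-- Regard the tree `M` as a plane tree, where the cyclic order of the edges around the vertex `v`
is `(v, 0), (v, 1), (v, 2)`. `M.FirstLeaf e l` says that, walking along the boundary of the plane
tree, starting along the edge at its end `e` and turning at every trivalent vertex to the next edge
in the cyclic order, the first leaf that is met is `l`. -/
inductive FirstLeaf (M : Pole L) : M.End → L → Prop
  | leaf (e : M.End) (l : L) (h : M.opp e = .inr l) : FirstLeaf M e l
  | turn (e : M.End) (v : M.V) (i : Fin 3) (l : L) (h : M.opp e = .inl (v, i))
      (hl : FirstLeaf M (.inl (v, i + 1)) l) : FirstLeaf M e l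

/-- `M` is the inscribed tree `S` of a cubic Halin graph whose perimeter circuit is
`v₀ v₁ … v_{k-1}`: it is a plane tree, with the leaf `i : Fin k` in the role of `v_i`, and the
perimeter circuit runs through the leaves in the order in which they occur around the plane tree
(so that the circuit together with the tree remains plane). -/
structure IsInscribedTree {k : ℕ} (M : Pole (Fin k)) : Prop where
  tree : M.IsTree
  three_le : 3 ≤ k
  around : ∀ i, M.FirstLeaf (.inr i) (finRotate k i)

end Pole

/-! ## Halin snarks -/

/-- The data from which a Halin snark is built: a cubic Halin graph with perimeter circuit
`v₀ v₁ … v_{k-1}`, given by its inscribed plane tree, and for each `i` a decollineator `D i`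
and a bipartite `(2,2;1)`-pole `B i`, which form the Halin fragment `D i ∘ B i` substituted
for `v_i`. -/
structure HalinData (T : Tetrahedron) where
  k : ℕ
  tree : Pole (Fin k)
  inscribed : tree.IsInscribedTree
  D : Fin k → Pole Semi22
  decollineator : ∀ i, (D i).IsDecollineator T
  B : Fin k → Pole Semi221
  bipartite : ∀ i, (B i).IsBipartitePole

/-- All junctions of a Halin snark: the output connector of `F_i` with the input connector of
`F_{i+1}` (indices modulo `k`), and the residual semiedge of `F_i` with the dangling edge of the
tree that led to the leaf `v_i`. -/
def closedJunctions (k : ℕ) : Junctions (Fin k × Semi221 ⊕ Fin k) Empty where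
  mate
    | .inl (i, .inp j) => .inl ((finRotate k).symm i, .out j)
    | .inl (i, .out j) => .inl (finRotate k i, .inp j)
    | .inl (i, .res) => .inr i
    | .inr i => .inl (i, .res)
  mate_mate := by rintro (⟨i, j | j | _⟩ | i) <;> simp [-finRotate_apply, -finRotate_symm_apply]
  keep := Empty.elim
  keep_injective := fun l => l.elim
  mate_eq_iff := by rintro (⟨i, j | j | _⟩ | i) <;> simp [-finRotate_apply, -finRotate_symm_apply]

/-- The junctions that remain when the two edges between `F_{s-1}` and `F_s` are severed; the free
ends that arise at `F_s` form the input connector, those at `F_{s-1}` the output connector. -/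
def severedJunctions {k : ℕ} (s : Fin k) : Junctions (Fin k × Semi221 ⊕ Fin k) Semi22 where
  mate
    | .inl (i, .inp j) =>
        if i = s then .inl (i, .inp j) else .inl ((finRotate k).symm i, .out j)
    | .inl (i, .out j) =>
        if finRotate k i = s then .inl (i, .out j) else .inl (finRotate k i, .inp j)
    | .inl (i, .res) => .inr i
    | .inr i => .inl (i, .res)
  mate_mate := by
    rintro (⟨i, j | j | _⟩ | i)
    · by_cases h : i = s <;> simp [h, -finRotate_apply, -finRotate_symm_apply]
    · by_cases h : finRotate k i = s <;> simp [h, -finRotate_apply, -finRotate_symm_apply]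
    · rfl
    · rfl
  keep
    | .inp j => .inl (s, .inp j)
    | .out j => .inl ((finRotate k).symm s, .out j)
  keep_injective := by rintro (a | a) (b | b) <;> simp
  mate_eq_iff := by
    rintro (⟨i, j | j | _⟩ | i)
    · by_cases h : i = s
      · subst h
        exact iff_of_true (by simp) ⟨.inp j, rfl⟩
      · refine iff_of_false (by simp [h, -finRotate_apply, -finRotate_symm_apply]) ?_
        rintro ⟨a | a, h'⟩ <;> simp [-finRotate_apply, -finRotate_symm_apply] at h'
        exact h h'.1.symm
    · by_cases h : finRotate k i = s
      · refine iff_of_true (by simp [h, -finRotate_apply, -finRotate_symm_apply]) ⟨.out j, ?_⟩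
        simp [← h, -finRotate_apply, -finRotate_symm_apply]
      · refine iff_of_false (by simp [h, -finRotate_apply, -finRotate_symm_apply]) ?_
        rintro ⟨a | a, h'⟩ <;> simp [-finRotate_apply, -finRotate_symm_apply] at h'
        exact h (by rw [← h'.1]; simp [-finRotate_apply, -finRotate_symm_apply])
    · refine iff_of_false (by simp) ?_
      rintro ⟨a | a, h'⟩ <;> simp [-finRotate_apply, -finRotate_symm_apply] at h'
    · refine iff_of_false (by simp) ?_
      rintro ⟨a | a, h'⟩ <;> simp [-finRotate_apply, -finRotate_symm_apply] at h'

namespace HalinData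

variable {T : Tetrahedron} (H : HalinData T)

/-- The Halin fragment `F_i = D_i ∘ B_i`. -/
noncomputable def fragment (i : Fin H.k) : Pole Semi221 :=
  join (H.D i) (H.B i)

/-- The disjoint union of all Halin fragments and of the tree without its leaves. -/
noncomputable def pieces : Pole (Fin H.k × Semi221 ⊕ Fin H.k) :=
  (Pole.sigma H.fragment).sum H.tree

/-- The Halin snark. -/
noncomputable def snark : Pole Empty :=
  H.pieces.glue (closedJunctions H.k)

/-- The extended Halin `(2,2)`-pole obtained from the Halin snark by severing the pair of edges
that connect the consecutive Halin fragments `F_{s-1}` and `F_s`. -/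
noncomputable def extendedPole (s : Fin H.k) : Pole Semi22 :=
  H.pieces.glue (severedJunctions s)

end HalinData

end HalinSnarks

namespace HalinSnarks
namespace Pole

variable {L L' : Type}

theorem IsFlow.opp {M : Pole L} {T : Tetrahedron} {φ : M.End → Vec} (h : M.IsFlow T φ)
    (e : M.End) : φ (M.opp e) = φ e := h.1 e

theorem map_mate_map_mate (M : Pole L) (J : Junctions L L') (x : M.End) :
    Sum.map id J.mate (Sum.map id J.mate x) = x := by
  rcases x with x | x <;> simp [J.mate_mate]

theorem map_mate_map_keep (M : Pole L) (J : Junctions L L') (e : (M.V × Fin 3) ⊕ L') :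
    Sum.map id J.mate (Sum.map id J.keep e : M.End) = Sum.map id J.keep e := by
  rcases e with e | l
  · rfl
  · simp [(J.mate_eq_iff (J.keep l)).2 ⟨l, rfl⟩]

theorem map_keep_injective (M : Pole L) (J : Junctions L L') :
    Function.Injective (Sum.map id J.keep : (M.V × Fin 3) ⊕ L' → M.End) :=
  Function.Injective.sumMap Function.injective_id J.keep_injective

theorem jump_injective (M : Pole L) (J : Junctions L L') : Function.Injective (M.jump J) := by
  intro x y hxy
  have h1 := congrArg M.opp hxy
  simp only [jump, M.opp_opp] at h1
  have h2 := congrArg (Sum.map id J.mate) h1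
  rwa [map_mate_map_mate, map_mate_map_mate] at h2

theorem jump_keep (M : Pole L) (J : Junctions L L') (e : (M.V × Fin 3) ⊕ L') :
    M.jump J (Sum.map id J.keep e) = M.opp (Sum.map id J.keep e) := by
  rw [jump, map_mate_map_keep]

/-- Crossing the junction reverses the direction of a walk along an edge. -/
theorem iterate_jump_mate_iterate_jump (M : Pole L) (J : Junctions L L') (n : ℕ) (x : M.End) :
    (M.jump J)^[n] (Sum.map id J.mate ((M.jump J)^[n] x)) = Sum.map id J.mate x := by
  induction n generalizing x with
  | zero => rfl
  | succ n ih =>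
    rw [Function.iterate_succ_apply (M.jump J) n x, Function.iterate_succ_apply', ih]
    simp only [jump, map_mate_map_mate, M.opp_opp]

/-- If a walk from one end of an edge meets an end that is not joined, then that end belongs to the
same edge. -/
theorem eq_of_iterate_jump_eq_keep {α : Type*} (M : Pole L) (J : Junctions L L') [Finite L]
    (φ : (M.V × Fin 3) ⊕ L' → α) (hφ : ∀ e, φ (M.glueOpp J e) = φ e) (n : ℕ)
    (e e' : (M.V × Fin 3) ⊕ L')
    (h : (M.jump J)^[n] (Sum.map id J.keep e) = Sum.map id J.keep e') : φ e = φ e' := by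
  classical
  induction n using Nat.strong_induction_on generalizing e with
  | _ n ih =>
    rcases n with _ | n
    · rw [M.map_keep_injective J h]
    · rw [Function.iterate_succ_apply, jump_keep] at h
      rcases lt_or_ge n (M.runLength J e) with hn | hn
      · refine absurd ?_ (Nat.find_min (M.exists_jump_fixed J e) hn)
        rw [h, map_mate_map_keep]
      · obtain ⟨m, rfl⟩ := Nat.exists_eq_add_of_le' hn
        rw [Function.iterate_add_apply] at h
        change (M.jump J)^[m] (M.run J e) = _ at h
        rw [← keep_glueOpp] at h
        rw [← hφ, ih m (by omega) _ h]

/-- A valuation of the edges of `M.glue J` comes from a valuation of the edges of `M`. -/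
theorem exists_valuation_of_glue {α : Type*} (M : Pole L) (J : Junctions L L') [Finite L]
    (φ : (M.V × Fin 3) ⊕ L' → α) (hφ : ∀ e, φ (M.glueOpp J e) = φ e) (p : α → Prop)
    (hp : ∀ e, p (φ e)) (hne : ∃ a, p a) :
    ∃ ψ : M.End → α, (∀ x, ψ (M.opp x) = ψ x) ∧ (∀ x, p (ψ x)) ∧
      (∀ x, ψ (Sum.map id J.mate x) = ψ x) ∧ ∀ e, ψ (Sum.map id J.keep e) = φ e := by
  classical
  have := M.finite_V
  obtain ⟨a, ha⟩ := hne
  have hinj := M.jump_injective J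
  let reach (x : M.End) : Prop := ∃ e n, (M.jump J)^[n] (Sum.map id J.keep e) = x
  let ψ (x : M.End) : α := if h : reach x then φ h.choose else a
  have hψ : ∀ n e, ψ ((M.jump J)^[n] (Sum.map id J.keep e)) = φ e := by
    intro n e
    have hr : reach ((M.jump J)^[n] (Sum.map id J.keep e)) := ⟨e, n, rfl⟩
    simp only [ψ, dif_pos hr]
    obtain ⟨m, hm⟩ := hr.choose_spec
    generalize hr.choose = e' at hm ⊢
    clear hr
    rcases le_total m n with h | h
    · obtain ⟨d, rfl⟩ := Nat.exists_eq_add_of_le h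
      rw [Function.iterate_add_apply] at hm
      exact (M.eq_of_iterate_jump_eq_keep J φ hφ d _ _ (hinj.iterate m hm).symm).symm
    · obtain ⟨d, rfl⟩ := Nat.exists_eq_add_of_le h
      rw [Function.iterate_add_apply] at hm
      exact M.eq_of_iterate_jump_eq_keep J φ hφ d _ _ (hinj.iterate n hm)
  have hjump : ∀ x, ψ (M.jump J x) = ψ x := by
    intro x
    by_cases hx : reach x
    · obtain ⟨e, n, rfl⟩ := hx
      rw [hψ, ← Function.iterate_succ_apply' (M.jump J), hψ]
    · have hx' : ¬ reach (M.jump J x) := by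
        rintro ⟨e, n, h⟩
        rcases n with _ | n
        · obtain ⟨m, hm, hp⟩ := Function.mem_periodicPts.1 (hinj.mem_periodicPts x)
          refine hx ⟨e, m - 1, ?_⟩
          rw [show Sum.map id J.keep e = _ from h, ← Function.iterate_succ_apply,
            show (m - 1).succ = m by omega]
          exact hp
        · rw [Function.iterate_succ_apply'] at h
          exact hx ⟨e, n, hinj h⟩
      simp only [ψ, dif_neg hx, dif_neg hx']
  have hiter : ∀ n x, ψ ((M.jump J)^[n] x) = ψ x := by
    intro n
    induction n with
    | zero => exact fun _ => rfl
    | succ n ih =>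
      intro x
      rw [Function.iterate_succ_apply, ih, hjump]
  have hmate' : ∀ x, reach x → ψ (Sum.map id J.mate x) = ψ x := by
    rintro x ⟨e, n, rfl⟩
    rw [hψ, ← hiter n, iterate_jump_mate_iterate_jump, map_mate_map_keep]
    exact hψ 0 e
  have hmate : ∀ x, ψ (Sum.map id J.mate x) = ψ x := by
    intro x
    by_cases hx : reach x
    · exact hmate' x hx
    by_cases hx' : reach (Sum.map id J.mate x)
    · have := hmate' _ hx'
      rw [map_mate_map_mate] at this
      exact this.symm
    · simp only [ψ, dif_neg hx, dif_neg hx']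
  refine ⟨ψ, fun x => ?_, fun x => ?_, hmate, fun e => hψ 0 e⟩
  · have := hjump (Sum.map id J.mate x)
    rw [jump, map_mate_map_mate] at this
    rw [this, hmate]
  · by_cases hx : reach x
    · simp only [ψ, dif_pos hx]
      exact hp _
    · simp only [ψ, dif_neg hx]
      exact ha

/-- A `T`-flow on `M.glue J` comes from a `T`-flow on `M`. -/
theorem IsFlow.exists_of_glue {M : Pole L} {J : Junctions L L'} [Finite L] {T : Tetrahedron}
    {φ : (M.glue J).End → Vec} (h : (M.glue J).IsFlow T φ) :
    ∃ ψ : M.End → Vec, M.IsFlow T ψ ∧ (∀ l, ψ (.inr (J.mate l)) = ψ (.inr l)) ∧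
      ∀ l, ψ (.inr (J.keep l)) = φ (.inr l) := by
  obtain ⟨ψ, hopp, hpt, hmate, hkeep⟩ := M.exists_valuation_of_glue J φ h.1 T.IsPoint h.2.1
    ⟨T.c 0, .inl ⟨0, rfl⟩⟩
  refine ⟨ψ, ⟨hopp, hpt, fun v => ?_⟩, fun l => hmate (.inr l), fun l => hkeep (.inr l)⟩
  have hv : ∀ i, ψ (.inl (v, i)) = φ (.inl (v, i)) := fun i => hkeep (.inl (v, i))
  rw [hv, hv, hv]
  exact h.2.2 v

theorem IsFlow.sumL {M : Pole L} {N : Pole L'} {T : Tetrahedron} {φ : (M.sum N).End → Vec}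
    (h : (M.sum N).IsFlow T φ) : M.IsFlow T (φ ∘ M.sumL N) := by
  refine ⟨?_, fun e => h.2.1 _, fun v => h.2.2 (.inl v)⟩
  rintro (⟨v, i⟩ | l)
  · exact h.1 (.inl (.inl v, i))
  · exact h.1 (.inr (.inl l))

theorem IsFlow.sumR {M : Pole L} {N : Pole L'} {T : Tetrahedron} {φ : (M.sum N).End → Vec}
    (h : (M.sum N).IsFlow T φ) : N.IsFlow T (φ ∘ M.sumR N) := by
  refine ⟨?_, fun e => h.2.1 _, fun v => h.2.2 (.inr v)⟩
  rintro (⟨v, i⟩ | l)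
  · exact h.1 (.inl (.inr v, i))
  · exact h.1 (.inr (.inr l))

theorem IsFlow.sigmaIn {I : Type} [Finite I] {M : I → Pole L} {T : Tetrahedron}
    {φ : (sigma M).End → Vec} (h : (sigma M).IsFlow T φ) (i : I) :
    (M i).IsFlow T (φ ∘ sigmaIn M i) := by
  refine ⟨?_, fun e => h.2.1 _, fun v => h.2.2 ⟨i, v⟩⟩
  rintro (⟨v, j⟩ | l)
  · exact h.1 (.inl (⟨i, v⟩, j))
  · exact h.1 (.inr (i, l))

end Pole
end HalinSnarks

namespace HalinSnarks

theorem vec_add_self (x : Vec) : x + x = 0 := by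
  ext i
  exact CharTwo.add_self_eq_zero _

/-- The Hamming weight of a vector. -/
def hammingWeight (v : Vec) : ℕ := (v 0).val + (v 1).val + (v 2).val + (v 3).val

/-- The relation between the Hamming weights of two vectors and of their sum. -/
def WeightTriangle (a b c : ℕ) : Prop :=
  (a + b + c) % 2 = 0 ∧ a ≤ b + c ∧ b ≤ a + c ∧ c ≤ a + b ∧ a + b + c ≤ 8

theorem weightTriangle_hammingWeight (a b : Vec) :
    WeightTriangle (hammingWeight a) (hammingWeight b) (hammingWeight (a + b)) := by
  have key : ∀ x y : ZMod 2, (x.val + y.val + (x + y).val) % 2 = 0 ∧ x.val ≤ y.val + (x + y).val ∧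
      y.val ≤ x.val + (x + y).val ∧ (x + y).val ≤ x.val + y.val ∧
      x.val + y.val + (x + y).val ≤ 2 := by decide
  have h0 := key (a 0) (b 0)
  have h1 := key (a 1) (b 1)
  have h2 := key (a 2) (b 2)
  have h3 := key (a 3) (b 3)
  simp only [WeightTriangle, hammingWeight, Pi.add_apply]
  omega

namespace Tetrahedron

variable (T : Tetrahedron)

/-- The coordinates of a vector with respect to the corner points of a tetrahedron. -/
noncomputable def coord : Vec ≃ₗ[ZMod 2] Vec :=
  (basisOfLinearIndependentOfCardEqFinrank T.general (by simp)).equivFun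

theorem coord_c (i : Fin 4) : T.coord (T.c i) = Pi.single i 1 := by
  have : T.c i = basisOfLinearIndependentOfCardEqFinrank T.general (by simp) i := by simp
  rw [coord]
  conv_lhs => rw [this]
  rw [Module.Basis.equivFun_apply, Module.Basis.repr_self, Finsupp.single_eq_pi_single]

/-- The weight of a vector with respect to a tetrahedron: `1` for corners, `2` for midpoints. -/
noncomputable def weight (x : Vec) : ℕ := hammingWeight (T.coord x)

theorem weightTriangle (x y : Vec) :
    WeightTriangle (T.weight x) (T.weight y) (T.weight (x + y)) := by
  simp only [weight, map_add]
  exact weightTriangle_hammingWeight _ _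

@[simp] theorem weight_zero : T.weight 0 = 0 := by
  simp [weight, hammingWeight]

@[simp] theorem weight_c (i : Fin 4) : T.weight (T.c i) = 1 := by
  rw [weight, coord_c]
  revert i
  decide

theorem weight_c_add_c {i j : Fin 4} (h : i ≠ j) : T.weight (T.c i + T.c j) = 2 := by
  rw [weight, map_add, coord_c, coord_c]
  revert i j
  decide

theorem IsPoint.weight_pos {T : Tetrahedron} {x : Vec} (h : T.IsPoint x) :
    T.weight x = 1 ∨ T.weight x = 2 := by
  rcases h with ⟨i, rfl⟩ | ⟨i, j, hij, rfl⟩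
  · exact .inl (T.weight_c i)
  · exact .inr (T.weight_c_add_c hij)

theorem IsLine.sum_eq_zero_and_weight {T : Tetrahedron} {x y z : Vec} (h : T.IsLine {x, y, z}) :
    x + y + z = 0 ∧ T.weight x + T.weight y + T.weight z = 4 := by
  obtain ⟨i, j, hij, hA⟩ := h
  have w1 := T.weight_c i
  have w2 := T.weight_c j
  have w3 := T.weight_c_add_c hij
  have hne1 : T.c i ≠ T.c j := by
    intro h
    rw [h, vec_add_self, weight_zero] at w3
    omega
  have hne2 : T.c i ≠ T.c i + T.c j := by
    intro h
    rw [← h] at w3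
    omega
  have hne3 : T.c j ≠ T.c i + T.c j := by
    intro h
    rw [← h] at w3
    omega
  have hx : x = T.c i ∨ x = T.c i + T.c j ∨ x = T.c j := by
    have : x ∈ ({x, y, z} : Set Vec) := by simp
    rwa [hA] at this
  have hy : y = T.c i ∨ y = T.c i + T.c j ∨ y = T.c j := by
    have : y ∈ ({x, y, z} : Set Vec) := by simp
    rwa [hA] at this
  have hz : z = T.c i ∨ z = T.c i + T.c j ∨ z = T.c j := by
    have : z ∈ ({x, y, z} : Set Vec) := by simp
    rwa [hA] at this
  have h1 : T.c i ∈ ({x, y, z} : Set Vec) := by simp [hA]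
  have h2 : T.c j ∈ ({x, y, z} : Set Vec) := by simp [hA]
  have h3 : T.c i + T.c j ∈ ({x, y, z} : Set Vec) := by simp [hA]
  simp only [Set.mem_insert_iff, Set.mem_singleton_iff] at h1 h2 h3
  have hs : T.c i + T.c j + (T.c i + T.c j) = 0 := vec_add_self _
  generalize hm : T.c i + T.c j = m at *
  generalize T.c i = p at *
  generalize T.c j = q at *
  subst hm
  rcases hx with rfl | rfl | rfl <;> rcases hy with rfl | rfl | rfl <;>
    rcases hz with rfl | rfl | rfl <;> first
    | (exfalso; simp_all; done)
    | exact ⟨Eq.trans (by abel) hs, by omega⟩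

/-- Two points of a tetrahedron are collinear if their sum is a corner, or if they are two corners
whose sum is a midpoint. -/
theorem collinear_of_weight {T : Tetrahedron} {p q : Vec} (hp : T.IsPoint p) (hq : T.IsPoint q)
    (h : T.weight (p + q) = 1 ∨ T.weight (p + q) = 2 ∧ T.weight p + T.weight q = 2) :
    T.Collinear s(p, q) := by
  have aux (i k l : Fin 4) (hkl : k ≠ l) (h : T.weight (T.c i + (T.c k + T.c l)) = 1) :
      i = k ∨ i = l := by
    rw [weight, map_add, map_add, coord_c, coord_c, coord_c] at h
    revert i k l
    decide
  have hc (i k l : Fin 4) (hkl : k ≠ l) (h : i = k ∨ i = l) :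
      ∃ A, T.IsLine A ∧ ∀ x ∈ s(T.c i, T.c k + T.c l), x ∈ A := by
    refine ⟨_, ⟨k, l, hkl, rfl⟩, ?_⟩
    intro x hx
    rcases Sym2.mem_iff.1 hx with rfl | rfl <;> rcases h with rfl | rfl <;> simp
  refine ⟨?_, ?_⟩
  · rw [Sym2.mk_isDiag_iff]
    rintro rfl
    rw [vec_add_self, weight_zero] at h
    omega
  · have htri := T.weightTriangle p q
    simp only [WeightTriangle] at htri
    rcases hp with ⟨i, rfl⟩ | ⟨i, j, hij, rfl⟩ <;> rcases hq with ⟨k, rfl⟩ | ⟨k, l, hkl, rfl⟩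
    · have hik : i ≠ k := by
        rintro rfl
        rw [vec_add_self, weight_zero] at h
        omega
      refine ⟨_, ⟨i, k, hik, rfl⟩, ?_⟩
      intro x hx
      rcases Sym2.mem_iff.1 hx with rfl | rfl <;> simp
    · rw [weight_c, weight_c_add_c T hkl] at h
      exact hc i k l hkl (aux i k l hkl (by omega))
    · rw [weight_c, weight_c_add_c T hij, add_comm] at h
      rw [Sym2.eq_swap]
      exact hc k i j hij (aux k i j hij (by omega))
    · rw [weight_c_add_c T hij, weight_c_add_c T hkl] at *
      omega

theorem hasShape_ls_of_weight {T : Tetrahedron} {p q : Vec} (hp : T.IsPoint p) (hq : T.IsPoint q)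
    (h : T.weight (p + q) = 2) (h' : T.weight p + T.weight q = 2) :
    T.HasShape s(p, q) .ls := by
  rcases hp with ⟨i, rfl⟩ | ⟨i, j, hij, rfl⟩ <;> rcases hq with ⟨k, rfl⟩ | ⟨k, l, hkl, rfl⟩
  · refine ⟨i, k, ?_, rfl⟩
    rintro rfl
    rw [vec_add_self, weight_zero] at h
    omega
  · rw [weight_c, weight_c_add_c T hkl] at h'
    omega
  · rw [weight_c, weight_c_add_c T hij] at h'
    omega
  · rw [weight_c_add_c T hij, weight_c_add_c T hkl] at h'
    omega

theorem hasShape_ang_of_weight {T : Tetrahedron} {p q : Vec} (hp : T.IsPoint p) (hq : T.IsPoint q)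
    (h : T.weight (p + q) = 2) (h' : T.weight p + T.weight q = 4) :
    T.HasShape s(p, q) .ang := by
  have aux (i j k l : Fin 4) (hij : i ≠ j) (hkl : k ≠ l)
      (h : T.weight (T.c i + T.c j + (T.c k + T.c l)) = 2) :
      i = k ∧ j ≠ l ∨ i = l ∧ j ≠ k ∨ j = k ∧ i ≠ l ∨ j = l ∧ i ≠ k := by
    rw [weight, map_add, map_add, map_add, coord_c, coord_c, coord_c, coord_c] at h
    revert i j k l
    decide
  rcases hp with ⟨i, rfl⟩ | ⟨i, j, hij, rfl⟩ <;> rcases hq with ⟨k, rfl⟩ | ⟨k, l, hkl, rfl⟩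
  · rw [weight_c, weight_c] at h'
    omega
  · rw [weight_c, weight_c_add_c T hkl] at h'
    omega
  · rw [weight_c, weight_c_add_c T hij] at h'
    omega
  · rcases aux i j k l hij hkl h with ⟨rfl, hne⟩ | ⟨rfl, hne⟩ | ⟨rfl, hne⟩ | ⟨rfl, hne⟩
    · exact ⟨i, j, l, hij, hkl, hne, rfl⟩
    · exact ⟨i, j, k, hij, hkl.symm, hne, by rw [add_comm (T.c k)]⟩
    · exact ⟨j, i, l, hij.symm, hkl, hne, by rw [add_comm (T.c i)]⟩
    · exact ⟨j, i, k, hij.symm, hkl.symm, hne, by rw [add_comm (T.c i), add_comm (T.c k)]⟩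

/-- The weights of the sum and of the members of a pair of points with a given shape. -/
theorem HasShape.weights {T : Tetrahedron} {P : Sym2 Vec} {σ : Shape} (h : T.HasShape P σ) :
    ∃ p q, P = s(p, q) ∧
      match σ with
      | .ls => T.weight (p + q) = 2 ∧ T.weight p + T.weight q = 2
      | .hl => T.weight p + T.weight q = 3
      | .ang => T.weight (p + q) = 2 ∧ T.weight p + T.weight q = 4
      | .alt => T.weight p + T.weight q = 3
      | .ax => T.weight (p + q) = 4
      | .dpt => T.weight (p + q) = 0 := by
  cases σ with
  | ls =>
    obtain ⟨i, j, hij, rfl⟩ := h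
    exact ⟨_, _, rfl, by rw [weight_c_add_c T hij], by simp⟩
  | hl =>
    obtain ⟨i, j, hij, rfl⟩ := h
    exact ⟨_, _, rfl, by simp [weight_c_add_c T hij]⟩
  | ang =>
    obtain ⟨i, j, k, hij, hik, hjk, rfl⟩ := h
    refine ⟨_, _, rfl, ?_, by rw [weight_c_add_c T hij, weight_c_add_c T hik]⟩
    rw [add_add_add_comm, vec_add_self, zero_add, weight_c_add_c T hjk]
  | alt =>
    obtain ⟨i, j, k, hij, hik, hjk, rfl⟩ := h
    exact ⟨_, _, rfl, by simp [weight_c_add_c T hjk]⟩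
  | ax =>
    obtain ⟨i, j, k, l, hij, hik, hil, hjk, hjl, hkl, rfl⟩ := h
    refine ⟨_, _, rfl, ?_⟩
    have aux : ∀ i j k l : Fin 4, [i, j, k, l].Nodup → hammingWeight
        (Pi.single i 1 + Pi.single j 1 + (Pi.single k 1 + Pi.single l 1)) = 4 := by decide
    simp only [weight, map_add, coord_c]
    exact aux i j k l (by simp [*])
  | dpt =>
    rcases h with ⟨i, rfl⟩ | ⟨i, j, hij, rfl⟩
    · exact ⟨_, _, rfl, by simp [vec_add_self]⟩
    · exact ⟨_, _, rfl, by simp [vec_add_self]⟩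

/-- An angle and a line segment never have the same shape. -/
theorem not_stationary_of_ang_ls {T : Tetrahedron} {P Q : Sym2 Vec} (hP : T.HasShape P .ang)
    (hQ : T.HasShape Q .ls) : ¬ T.Stationary P Q := by
  rintro ⟨σ, hP', hQ'⟩
  obtain ⟨p, q, rfl, h1⟩ := hP.weights
  obtain ⟨p', q', hp, h2⟩ := hP'.weights
  obtain ⟨r, t, rfl, h3⟩ := hQ.weights
  obtain ⟨r', t', hr, h4⟩ := hQ'.weights
  have hp' : T.weight (p + q) = T.weight (p' + q') ∧
      T.weight p + T.weight q = T.weight p' + T.weight q' := by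
    rcases Sym2.eq_iff.1 hp with ⟨rfl, rfl⟩ | ⟨rfl, rfl⟩
    · exact ⟨rfl, rfl⟩
    · exact ⟨by rw [add_comm], add_comm _ _⟩
  have hr' : T.weight r + T.weight t = T.weight r' + T.weight t' := by
    rcases Sym2.eq_iff.1 hr with ⟨rfl, rfl⟩ | ⟨rfl, rfl⟩
    · rfl
    · exact add_comm _ _
  simp only at h1 h3
  cases σ <;> simp only at h2 h4 <;> omega

end Tetrahedron
end HalinSnarks

namespace HalinSnarks

/-- The semiedges of a `(2,2;1)`-pole, sorted by connectors. -/
def semi221Equiv : Fin 2 ⊕ (Fin 2 ⊕ Unit) ≃ Semi221 where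
  toFun := Sum.elim .inp (Sum.elim .out fun _ => .res)
  invFun
    | .inp j => .inl j
    | .out j => .inr (.inl j)
    | .res => .inr (.inr ())
  left_inv := by rintro (_ | _ | _) <;> rfl
  right_inv := by rintro (_ | _ | _) <;> rfl

namespace Pole

variable {L : Type}

/-- Kirchhoff's law: the values of a flow on the semiedges sum to zero. -/
theorem IsFlow.sum_semiedges [Fintype L] {M : Pole L} {T : Tetrahedron} {φ : M.End → Vec}
    (h : M.IsFlow T φ) : ∑ l, φ (.inr l) = 0 := by
  have := M.finite_V
  have := Fintype.ofFinite M.V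
  have h1 : ∑ e : M.End, φ e = 0 :=
    Finset.sum_involution (fun e _ => M.opp e) (fun e _ => by rw [h.opp, vec_add_self])
      (fun e _ _ => M.opp_ne e) (fun _ _ => Finset.mem_univ _) (fun e _ => M.opp_opp e)
  rw [Fintype.sum_sum_type, Fintype.sum_prod_type, Finset.sum_eq_zero, zero_add] at h1
  · exact h1
  · intro v _
    rw [Fin.sum_univ_three]
    exact (h.2.2 v).sum_eq_zero_and_weight.1

/-- The sign of a vertex with respect to a bipartition. -/
def bipartiteSign {V : Type} (side : V → Bool) (v : V) : ℤ := if side v then 1 else -1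

theorem bipartiteSign_of_ne {V : Type} {side : V → Bool} {x y : V} (h : side x ≠ side y) :
    bipartiteSign side x = - bipartiteSign side y := by
  unfold bipartiteSign
  cases hx : side x <;> cases hy : side y <;> simp_all

/-- The two sides of the bipartition of a cubic graph have the same size. -/
theorem sum_bipartiteSign (G : Pole Empty) [Fintype G.V] {side : G.V → Bool}
    (hside : ∀ e x y, G.vert e = some x → G.vert (G.opp e) = some y → side x ≠ side y) :
    ∑ v, bipartiteSign side v = 0 := by
  let s : G.End → ℤ := Sum.elim (fun e => bipartiteSign side e.1) Empty.elim
  have hs : ∀ e, s (G.opp e) = - s e := by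
    rintro (⟨v, i⟩ | l)
    · rcases hx : G.opp (.inl (v, i)) with ⟨w, j⟩ | l
      · exact bipartiteSign_of_ne (hside _ v w rfl (by rw [hx]; rfl)).symm
      · exact l.elim
    · exact l.elim
  have h1 : ∑ e : G.End, s e = ∑ e : G.End, s (G.opp e) :=
    (Equiv.sum_comp (Function.Involutive.toPerm G.opp G.opp_opp) s).symm
  simp only [hs, Finset.sum_neg_distrib] at h1
  have h2 : ∑ e : G.End, s e = 3 * ∑ v, bipartiteSign side v := by
    rw [Fintype.sum_sum_type, Fintype.sum_prod_type, Finset.mul_sum]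
    simp [s]
  omega

/-- In a bipartite `(2,2;1)`-pole, a valuation of the edges by integers whose values at each vertex
sum to one has total value one more on the connectors than on the residual semiedge. -/
theorem IsBipartitePole.sum_connectors {B : Pole Semi221} (hB : B.IsBipartitePole)
    (f : B.End → ℤ) (hopp : ∀ e, f (B.opp e) = f e)
    (hf : ∀ v, f (.inl (v, 0)) + f (.inl (v, 1)) + f (.inl (v, 2)) = 1) :
    f (.inr (.inp 0)) + f (.inr (.inp 1)) + (f (.inr (.out 0)) + f (.inr (.out 1))) =
      f (.inr .res) + 1 := by
  classical
  obtain ⟨G, u, w, v, a, b, g, j, ⟨side, hside⟩, hr⟩ := hB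
  have := G.finite_V
  have := B.finite_V
  have := Fintype.ofFinite G.V
  have := Fintype.ofFinite B.V
  let _ : Fintype Semi221 := Fintype.ofEquiv _ semi221Equiv
  have huw : bipartiteSign side u = - bipartiteSign side w :=
    bipartiteSign_of_ne (hside a u w hr.vert_a hr.vert_opp_a)
  have hwv : bipartiteSign side w = - bipartiteSign side v :=
    bipartiteSign_of_ne (hside b w v hr.vert_b hr.vert_opp_b)
  have hunit : bipartiteSign side u ≠ 0 := by
    unfold bipartiteSign
    split <;> simp
  let s : B.End → ℤ := Sum.elim (fun e => bipartiteSign side (g e.1)) fun l => match l with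
    | .inp _ => bipartiteSign side u
    | .out _ => bipartiteSign side v
    | .res => bipartiteSign side w
  have hvert : ∀ e, ∃ x, G.vert (j e) = some x ∧ s e = bipartiteSign side x := by
    rintro (⟨x, i⟩ | i | i | _)
    · exact ⟨_, hr.vert_j x i, rfl⟩
    · exact ⟨_, hr.vert_inp i, rfl⟩
    · exact ⟨_, hr.vert_out i, rfl⟩
    · exact ⟨_, hr.vert_res, rfl⟩
  have hs : ∀ e, s (B.opp e) = - s e := by
    intro e
    obtain ⟨x, hx, hsx⟩ := hvert e
    obtain ⟨y, hy, hsy⟩ := hvert (B.opp e)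
    rw [hr.j_opp] at hy
    rw [hsx, hsy]
    exact bipartiteSign_of_ne (hside _ x y hx hy).symm
  have h1 : ∑ e : B.End, s e * f e = ∑ e : B.End, s (B.opp e) * f (B.opp e) :=
    (Equiv.sum_comp (Function.Involutive.toPerm B.opp B.opp_opp) fun e => s e * f e).symm
  simp only [hs, hopp, neg_mul, Finset.sum_neg_distrib] at h1
  have h2 : ∑ e : B.End, s e * f e = ∑ x, bipartiteSign side (g x) +
      (bipartiteSign side u * (f (.inr (.inp 0)) + f (.inr (.inp 1))) +
        (bipartiteSign side v * (f (.inr (.out 0)) + f (.inr (.out 1))) +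
          bipartiteSign side w * f (.inr .res))) := by
    rw [Fintype.sum_sum_type, Fintype.sum_prod_type]
    congr 1
    · refine Finset.sum_congr rfl fun x _ => ?_
      rw [Fin.sum_univ_three]
      change bipartiteSign side (g x) * _ + bipartiteSign side (g x) * _ +
        bipartiteSign side (g x) * _ = _
      rw [← mul_add, ← mul_add, hf, mul_one]
    · rw [← Equiv.sum_comp semi221Equiv]
      simp [semi221Equiv, s, mul_add]
  have h3 : ∑ x, bipartiteSign side (g x) + (bipartiteSign side u + bipartiteSign side w +
      bipartiteSign side v) = 0 := by
    rw [← sum_bipartiteSign G hside, ← Finset.sum_add_sum_compl (Finset.univ.image g)]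
    congr 1
    · rw [Finset.sum_image hr.f_injective.injOn]
    · have : (Finset.univ.image g)ᶜ = {u, w, v} := by
        apply Finset.coe_injective
        simp [hr.range_f]
      rw [this, Finset.sum_insert (by simp [hr.u_ne_w, hr.u_ne_v]),
        Finset.sum_insert (by simp [hr.w_ne_v]), Finset.sum_singleton, add_assoc]
  have hvu : bipartiteSign side v = bipartiteSign side u := by omega
  have hwu : bipartiteSign side w = - bipartiteSign side u := by omega
  rw [hvu, hwu] at h2 h3
  have h4 : bipartiteSign side u * (f (.inr (.inp 0)) + f (.inr (.inp 1)) +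
      (f (.inr (.out 0)) + f (.inr (.out 1))) - (f (.inr .res) + 1)) = 0 := by
    have h0 : ∑ e, s e * f e = 0 := by omega
    linear_combination h0 - h2 - h3
  have := (mul_eq_zero.1 h4).resolve_left hunit
  omega

end Pole

/-- The possible weights in a transition `P → Q` through a Halin fragment: an entry
`(w, m, x, w', m')` lists the weight of the sum of `P`, the total weight of `P`, the weight of the
residual value, the weight of the sum of `Q`, and the total weight of `Q`. -/
def fragmentWeights : List (ℕ × ℕ × ℕ × ℕ × ℕ) :=
  [(0, 2, 1, 1, 3), (0, 2, 2, 2, 2), (0, 2, 2, 2, 4), (0, 4, 1, 1, 3), (0, 4, 2, 2, 2),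
    (0, 4, 2, 2, 4), (2, 2, 2, 0, 2), (2, 2, 2, 2, 2), (2, 4, 1, 1, 3), (2, 4, 1, 3, 3),
    (2, 4, 2, 0, 2), (2, 4, 2, 0, 4), (2, 4, 2, 2, 2), (2, 4, 2, 2, 4), (2, 4, 2, 4, 4),
    (3, 3, 1, 2, 2), (3, 3, 2, 1, 3), (3, 3, 2, 3, 3), (4, 4, 2, 2, 2)]

/-- The possible weights in a transition through a sequence of at least two Halin fragments whose
residual semiedges are joined by a binary tree; the entries are as in `fragmentWeights`. -/
def chainWeights : List (ℕ × ℕ × ℕ × ℕ × ℕ) :=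
  [(0, 2, 1, 1, 3), (0, 4, 1, 1, 3), (2, 2, 1, 1, 3), (2, 4, 1, 1, 3), (2, 4, 1, 3, 3),
    (2, 4, 2, 2, 2), (3, 3, 1, 2, 2), (3, 3, 2, 1, 3)]

instance (a b c : ℕ) : Decidable (WeightTriangle a b c) := by
  unfold WeightTriangle
  infer_instance

/-- The possible total weights `m` of a pair of points whose sum has weight `w`. -/
def PairWeights (w m : ℕ) : Prop := 2 ≤ m ∧ (w + m) % 2 = 0 ∧ w ≤ m

instance (w m : ℕ) : Decidable (PairWeights w m) := by
  unfold PairWeights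
  infer_instance

theorem mem_fragmentWeights {w m n x w' m' : ℕ} (hm : PairWeights w m) (hm4 : m ≤ 4)
    (hn : PairWeights w n) (hn4 : n ≤ 4) (hm' : PairWeights w' m') (hm4' : m' ≤ 4)
    (hx : x = 1 ∨ x = 2) (ht : WeightTriangle w w' x)
    (hcol : ¬ ((w = 1 ∨ w = 2 ∧ m = 2) ∧ (w = 1 ∨ w = 2 ∧ n = 2))) (hbal : n + m' = x + 4) :
    (w, m, x, w', m') ∈ fragmentWeights := by
  have key : ∀ w m n : Fin 5, ∀ x : Fin 3, ∀ w' : Fin 5, PairWeights w m → PairWeights w n →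
      PairWeights w' (x.1 + 4 - n.1) → x.1 + 4 - n.1 ≤ 4 → x.1 ≠ 0 → WeightTriangle w w' x →
      (w.1, m.1, x.1, w'.1, x.1 + 4 - n.1) ∉ fragmentWeights →
      (w.1 = 1 ∨ w.1 = 2 ∧ m.1 = 2) ∧ (w.1 = 1 ∨ w.1 = 2 ∧ n.1 = 2) := by decide +kernel
  obtain rfl : m' = x + 4 - n := by omega
  have h1 := hm.2.2
  have h2 := hm'.2.2
  by_contra hmem
  exact hcol (key ⟨w, by omega⟩ ⟨m, by omega⟩ ⟨n, by omega⟩ ⟨x, by omega⟩ ⟨w', by omega⟩ hm hn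
    hm' hm4' (show x ≠ 0 by omega) ht hmem)

theorem mem_chainWeights {w m x w' m' y w'' m'' z : ℕ}
    (h : (w, m, x, w', m') ∈ fragmentWeights ++ chainWeights)
    (h' : (w', m', y, w'', m'') ∈ fragmentWeights ++ chainWeights)
    (hz : z + x + y = 4) (hz0 : z ≠ 0) (ht : WeightTriangle w w'' z) :
    (w, m, z, w'', m'') ∈ chainWeights := by
  have key : ∀ a ∈ fragmentWeights ++ chainWeights, ∀ b ∈ fragmentWeights ++ chainWeights,
      a.2.2.2 = (b.1, b.2.1) → a.2.2.1 + b.2.2.1 < 4 →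
      WeightTriangle a.1 b.2.2.2.1 (4 - (a.2.2.1 + b.2.2.1)) →
      (a.1, a.2.1, 4 - (a.2.2.1 + b.2.2.1), b.2.2.2) ∈ chainWeights := by decide
  have e : z = 4 - (x + y) := by omega
  rw [e] at ht ⊢
  exact key _ h _ h' rfl (show x + y < 4 by omega) ht

/-- If the residual semiedges of a Halin fragment and of a longer sequence of fragments are joined
to each other, then only angles can be transformed, and only to line segments. -/
theorem weights_of_fragment_chain {w m x w' m' m'' : ℕ} (h : (w, m, x, w', m') ∈ fragmentWeights)
    (h' : (w', m', x, w, m'') ∈ chainWeights) : w = 2 ∧ m = 4 ∧ m'' = 2 := by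
  have key : ∀ a ∈ fragmentWeights, ∀ b ∈ chainWeights, a.2.2.2 = (b.1, b.2.1) →
      a.2.2.1 = b.2.2.1 → a.1 = b.2.2.2.1 → a.1 = 2 ∧ a.2.1 = 4 ∧ b.2.2.2.2 = 2 := by decide
  exact key _ h _ h' rfl rfl rfl

theorem pairWeights {T : Tetrahedron} {p q : Vec} (hp : T.IsPoint p) (hq : T.IsPoint q) :
    PairWeights (T.weight (p + q)) (T.weight p + T.weight q) ∧ T.weight p + T.weight q ≤ 4 := by
  have h := T.weightTriangle p q
  have h1 := hp.weight_pos
  have h2 := hq.weight_pos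
  simp only [WeightTriangle, PairWeights] at *
  omega

namespace Pole

theorem IsFlow.sum_semiedges_22 {D : Pole Semi22} {T : Tetrahedron} {φ : D.End → Vec}
    (h : D.IsFlow T φ) : φ (.inr (.inp 0)) + φ (.inr (.inp 1)) =
      φ (.inr (.out 0)) + φ (.inr (.out 1)) := by
  let iso : Fin 2 ⊕ Fin 2 ≃ Semi22 :=
    { toFun := Sum.elim .inp .out
      invFun := fun l => match l with
        | .inp j => .inl j
        | .out j => .inr j
      left_inv := by rintro (_ | _) <;> rfl
      right_inv := by rintro (_ | _) <;> rfl }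
  let _ : Fintype Semi22 := Fintype.ofEquiv _ iso
  have h1 := h.sum_semiedges
  rw [← Equiv.sum_comp iso] at h1
  simp only [iso, Equiv.coe_fn_mk, Fintype.sum_sum_type, Sum.elim_inl, Sum.elim_inr,
    Fin.sum_univ_two] at h1
  rw [add_eq_zero_iff_eq_neg] at h1
  rw [h1]
  exact neg_eq_of_add_eq_zero_left (vec_add_self _)

theorem IsFlow.sum_semiedges_221 {B : Pole Semi221} {T : Tetrahedron} {φ : B.End → Vec}
    (h : B.IsFlow T φ) : φ (.inr (.inp 0)) + φ (.inr (.inp 1)) +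
      (φ (.inr (.out 0)) + φ (.inr (.out 1))) = φ (.inr .res) := by
  let _ : Fintype Semi221 := Fintype.ofEquiv _ semi221Equiv
  have h1 := h.sum_semiedges
  rw [← Equiv.sum_comp semi221Equiv] at h1
  simp only [semi221Equiv, Equiv.coe_fn_mk, Fintype.sum_sum_type, Sum.elim_inl, Sum.elim_inr,
    Fin.sum_univ_two, Finset.univ_unique, Finset.sum_singleton] at h1
  rw [← add_assoc, add_eq_zero_iff_eq_neg] at h1
  rw [h1]
  exact neg_eq_of_add_eq_zero_left (vec_add_self _)

/-- The transitions through a Halin fragment. -/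
theorem IsFlow.mem_fragmentWeights {D : Pole Semi22} {B : Pole Semi221} {T : Tetrahedron}
    (hD : D.IsDecollineator T) (hB : B.IsBipartitePole) {φ : (join D B).End → Vec}
    (h : (join D B).IsFlow T φ) :
    (T.weight (φ (.inr (.inp 0)) + φ (.inr (.inp 1))),
      T.weight (φ (.inr (.inp 0))) + T.weight (φ (.inr (.inp 1))), T.weight (φ (.inr .res)),
      T.weight (φ (.inr (.out 0)) + φ (.inr (.out 1))),
      T.weight (φ (.inr (.out 0))) + T.weight (φ (.inr (.out 1)))) ∈ fragmentWeights := by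
  have hsum := h.sum_semiedges_221
  obtain ⟨ψ, hψ, hmate, hkeep⟩ := IsFlow.exists_of_glue h
  have hψD := hψ.sumL
  have hψB := hψ.sumR
  have hDsum := hψD.sum_semiedges_22
  have hdec := hD _ _ ⟨_, hψD, rfl, rfl⟩
  have hbal := hB.sum_connectors (fun e => (T.weight (ψ (D.sumR B e)) : ℤ) - 1)
    (fun e => by rw [show ψ (D.sumR B (B.opp e)) = ψ (D.sumR B e) from hψB.1 e])
    (fun v => by
      have := (hψB.2.2 v).sum_eq_zero_and_weight.2
      change T.weight (ψ (D.sumR B (.inl (v, 0)))) + T.weight (ψ (D.sumR B (.inl (v, 1)))) +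
        T.weight (ψ (D.sumR B (.inl (v, 2)))) = 4 at this
      omega)
  have hin (j : Fin 2) : ψ (D.sumL B (.inr (.inp j))) = φ (.inr (.inp j)) := hkeep (.inp j)
  have hmid (j : Fin 2) : ψ (D.sumR B (.inr (.inp j))) = ψ (D.sumL B (.inr (.out j))) :=
    hmate (.inl (.out j))
  have hout (j : Fin 2) : ψ (D.sumR B (.inr (.out j))) = φ (.inr (.out j)) := hkeep (.out j)
  have hres : ψ (D.sumR B (.inr .res)) = φ (.inr .res) := hkeep .res
  have hpt (e) : T.IsPoint (ψ (D.sumL B e)) := hψ.2.1 _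
  change ψ (D.sumL B (.inr (.inp 0))) + ψ (D.sumL B (.inr (.inp 1))) =
    ψ (D.sumL B (.inr (.out 0))) + ψ (D.sumL B (.inr (.out 1))) at hDsum
  change ¬ (T.Collinear s(ψ (D.sumL B (.inr (.inp 0))), ψ (D.sumL B (.inr (.inp 1)))) ∧
    T.Collinear s(ψ (D.sumL B (.inr (.out 0))), ψ (D.sumL B (.inr (.out 1))))) at hdec
  rw [hin, hin] at hDsum hdec
  simp only [hmid, hout, hres] at hbal
  have hin' := pairWeights (h.2.1 (.inr (.inp 0))) (h.2.1 (.inr (.inp 1)))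
  have hout' := pairWeights (h.2.1 (.inr (.out 0))) (h.2.1 (.inr (.out 1)))
  have hmid' := pairWeights (hpt (.inr (.out 0))) (hpt (.inr (.out 1)))
  rw [← hDsum] at hmid'
  refine HalinSnarks.mem_fragmentWeights hin'.1 hin'.2 hmid'.1 hmid'.2 hout'.1 hout'.2
    (h.2.1 _).weight_pos ?_ ?_ (by omega)
  · rw [← hsum]
    exact T.weightTriangle _ _
  · rintro ⟨h1, h2⟩
    refine hdec ⟨T.collinear_of_weight (h.2.1 _) (h.2.1 _) h1,
      T.collinear_of_weight (hpt _) (hpt _) ?_⟩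
    rwa [hDsum] at h2

end Pole
end HalinSnarks

/-- In a tree, a vertex has at most one neighbour that is closer to the root. -/
theorem SimpleGraph.IsTree.eq_of_adj_of_dist_eq_add_one {V : Type*} {G : SimpleGraph V}
    (hG : G.IsTree) {r v x y : V} (hx : G.Adj x v) (hy : G.Adj y v)
    (hdx : G.dist r v = G.dist r x + 1) (hdy : G.dist r v = G.dist r y + 1) : x = y := by
  have key (z : V) (hz : G.Adj z v) (hd : G.dist r v = G.dist r z + 1) :
      ∃ p : G.Walk r v, p.IsPath ∧ p.penultimate = z := by
    obtain ⟨p, hp⟩ := hG.connected.exists_walk_length_eq_dist r z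
    refine ⟨p.concat hz, SimpleGraph.Walk.isPath_of_length_eq_dist _ ?_, by simp⟩
    rw [SimpleGraph.Walk.length_concat, hp, hd]
  obtain ⟨p, hp, rfl⟩ := key x hx hdx
  obtain ⟨q, hq, rfl⟩ := key y hy hdy
  rw [(hG.existsUnique_path r v).unique hp hq]

theorem SimpleGraph.Connected.dist_lt_card {V : Type*} [Fintype V] {G : SimpleGraph V}
    (hG : G.Connected) (x y : V) : G.dist x y < Fintype.card V := by
  obtain ⟨p, hp, hl⟩ := hG.exists_path_of_dist x y
  rw [← hl]
  exact hp.length_lt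

namespace HalinSnarks
namespace Pole

theorem FirstLeaf.unique {L : Type} {M : Pole L} {e : M.End} {l l' : L} (h : M.FirstLeaf e l)
    (h' : M.FirstLeaf e l') : l = l' := by
  induction h with
  | leaf e l h =>
    cases h' with
    | leaf _ _ h1 => exact Sum.inr.inj (h.symm.trans h1)
    | turn _ v i _ h1 _ => rw [h] at h1; cases h1
  | turn e v i l h hl ih =>
    cases h' with
    | leaf _ _ h1 => rw [h] at h1; cases h1
    | turn _ v' i' _ h1 hl' =>
      rw [h] at h1
      cases h1
      exact ih hl'

theorem IsTree.adj {L : Type} {M : Pole L} (hM : M.IsTree) (e : M.End) :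
    M.graph.Adj (M.tip e) (M.tip (M.opp e)) :=
  ⟨(hM.no_loop e).symm, e, rfl, rfl⟩

/-- Walking away from the root `r` of a tree, one goes on walking away from the root after
passing a vertex. -/
theorem IsTree.dist_of_turn {L : Type} {M : Pole L} (hM : M.IsTree) (r : M.V ⊕ L) {e : M.End}
    {v : M.V} {i j : Fin 3} (he : M.opp e = .inl (v, i)) (hij : j ≠ i)
    (hd : M.graph.dist r (M.tip (M.opp e)) = M.graph.dist r (M.tip e) + 1) :
    M.graph.dist r (M.tip (M.opp (.inl (v, j)))) = M.graph.dist r (.inl v) + 1 := by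
  have ha := hM.adj (.inl (v, j))
  rcases hM.isTree.dist_eq_dist_add_one_of_adj r ha with h | h
  · have ha' := hM.adj e
    rw [he] at ha' hd
    have heq := hM.isTree.eq_of_adj_of_dist_eq_add_one ha'
      (by exact ha.symm) hd (by exact h)
    have hopp : M.opp (.inl (v, i)) = e := by rw [← he, M.opp_opp]
    have := hM.no_parallel (.inl (v, i)) (.inl (v, j)) rfl (by rw [hopp]; exact heq)
    simp only [Sum.inl.injEq, Prod.mk.injEq, true_and] at this
    exact absurd this.symm hij
  · exact h

/-- Induction along the branches of an inscribed tree that is rooted at its leaf `s`. Every edge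
`e` that leads away from the root determines a branch, whose leaves form an interval `a, …, b` with
respect to the cyclic order of the leaves; the branches at the next vertex split the interval. -/
theorem IsInscribedTree.branch_induction {k : ℕ} {M : Pole (Fin k)} (hM : M.IsInscribedTree)
    (s : Fin k) (C : M.End → Fin k → Fin k → Prop)
    (leaf : ∀ e l, M.opp e = .inr l → C e l l)
    (node : ∀ e v i a b c, M.opp e = .inl (v, i) → C (.inl (v, i + 1)) a b → finRotate k b ≠ s →
      C (.inl (v, i + 1 + 1)) (finRotate k b) c → C e a c) :
    (∃ v i, M.opp (.inr s) = .inl (v, i)) ∧ finRotate k s ≠ s ∧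
      ∃ c, C (.inr s) (finRotate k s) c ∧ finRotate k c = s := by
  have := M.finite_V
  have := Fintype.ofFinite M.V
  have main (n : ℕ) : ∀ e : M.End,
      Fintype.card (M.V ⊕ Fin k) ≤ M.graph.dist (.inr s) (M.tip e) + n →
      M.graph.dist (.inr s) (M.tip (M.opp e)) = M.graph.dist (.inr s) (M.tip e) + 1 →
      ∃ a b, M.FirstLeaf e a ∧ a ≠ s ∧ (∀ l, M.FirstLeaf (M.opp e) l → M.FirstLeaf (.inr b) l) ∧
        C e a b := by
    induction n with
    | zero =>
      intro e hn
      have := hM.tree.isTree.connected.dist_lt_card (.inr s) (M.tip e)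
      omega
    | succ n ih =>
      intro e hn hd
      rcases he : M.opp e with ⟨v, i⟩ | l
      · have hi1 : i + 1 ≠ i := (by decide : ∀ i : Fin 3, i + 1 ≠ i) i
        have hi2 : i + 1 + 1 ≠ i := (by decide : ∀ i : Fin 3, i + 1 + 1 ≠ i) i
        have hi3 : i + 1 + 1 + 1 = i := (by decide : ∀ i : Fin 3, i + 1 + 1 + 1 = i) i
        have hdv : M.graph.dist (.inr s) (.inl v) = M.graph.dist (.inr s) (M.tip e) + 1 := by
          rw [he] at hd
          exact hd
        obtain ⟨a, b, ha, has, hb, hC⟩ := ih (.inl (v, i + 1))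
          (by change _ ≤ M.graph.dist (.inr s) (.inl v) + n; omega)
          (hM.tree.dist_of_turn _ he hi1 hd)
        obtain ⟨a', c, ha', has', hc, hC'⟩ := ih (.inl (v, i + 1 + 1))
          (by change _ ≤ M.graph.dist (.inr s) (.inl v) + n; omega)
          (hM.tree.dist_of_turn _ he hi2 hd)
        obtain rfl : finRotate k b = a' :=
          (hM.around b).unique (hb _ (.turn _ v (i + 1) _ (M.opp_opp _) ha'))
        refine ⟨a, c, .turn _ v i _ he ha, has, fun l hl => ?_, node e v i a b c he hC has' hC'⟩
        refine hc _ (.turn _ v (i + 1 + 1) _ (M.opp_opp _) ?_)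
        rwa [hi3]
      · refine ⟨l, l, .leaf _ _ he, ?_, fun _ => id, leaf e l he⟩
        rintro rfl
        rw [he] at hd
        change M.graph.dist (.inr l) (.inr l) = _ at hd
        rw [SimpleGraph.dist_self] at hd
        omega
  have hd : M.graph.dist (.inr s) (M.tip (M.opp (.inr s))) =
      M.graph.dist (.inr s) (M.tip (.inr s)) + 1 := by
    change _ = M.graph.dist (.inr s) (.inr s) + 1
    rw [SimpleGraph.dist_self, zero_add, SimpleGraph.dist_eq_one_iff_adj]
    exact hM.tree.adj (.inr s)
  obtain ⟨a, c, ha, has, hc, hC⟩ := main _ (.inr s) (Nat.le_add_left _ _) hd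
  obtain rfl := (hM.around s).unique ha
  refine ⟨?_, has, c, hC, (hM.around c).unique (hc _ (.leaf _ _ (M.opp_opp _)))⟩
  rcases h : M.opp (.inr s) with ⟨v, i⟩ | l
  · exact ⟨v, i, rfl⟩
  · exfalso
    have h1 := (hM.around s).unique (.leaf _ _ h)
    have h2 := (hM.around l).unique (.leaf _ s (by rw [← h, M.opp_opp]))
    rw [← h1] at h2
    have h3 := hM.three_le
    obtain ⟨k, rfl⟩ : ∃ m, k = m + 3 := ⟨k - 3, by omega⟩
    rw [finRotate_apply, finRotate_apply, add_assoc, add_eq_left] at h2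
    simp only [Fin.ext_iff, Fin.val_add, Fin.val_one, Fin.val_zero] at h2
    rw [Nat.mod_eq_of_lt (by omega)] at h2
    omega

end Pole
end HalinSnarks

namespace HalinSnarks
namespace HalinData

variable {T : Tetrahedron} (H : HalinData T)

/-- The weights of two pairs of points and of a further point, arranged as in `fragmentWeights`. -/
noncomputable def weights (T : Tetrahedron) (p : Fin 2 → Vec) (x : Vec) (q : Fin 2 → Vec) :
    ℕ × ℕ × ℕ × ℕ × ℕ :=
  (T.weight (p 0 + p 1), T.weight (p 0) + T.weight (p 1), T.weight x, T.weight (q 0 + q 1),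
    T.weight (q 0) + T.weight (q 1))

/-- The transitions through an extended Halin `(2,2)`-pole in terms of weights. -/
theorem weights_of_isFlow_extendedPole (s : Fin H.k) {φ : (H.extendedPole s).End → Vec}
    (h : (H.extendedPole s).IsFlow T φ) :
    T.weight (φ (.inr (.inp 0)) + φ (.inr (.inp 1))) = 2 ∧
      T.weight (φ (.inr (.inp 0))) + T.weight (φ (.inr (.inp 1))) = 4 ∧
      T.weight (φ (.inr (.out 0)) + φ (.inr (.out 1))) = 2 ∧
      T.weight (φ (.inr (.out 0))) + T.weight (φ (.inr (.out 1))) = 2 := by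
  obtain ⟨ψ, hψ, hmate, hkeep⟩ := Pole.IsFlow.exists_of_glue h
  let τ : H.tree.End → Vec := fun e => ψ ((Pole.sigma H.fragment).sumR H.tree e)
  have hτ : H.tree.IsFlow T τ := hψ.sumR
  let p (i : Fin H.k) (j : Fin 2) : Vec := ψ (.inr (.inl (i, .inp j)))
  let q (i : Fin H.k) (j : Fin 2) : Vec := ψ (.inr (.inl (i, .out j)))
  have hres (i) : ψ (.inr (.inl (i, .res))) = τ (.inr i) := hmate (.inr i)
  have hfrag (i) : weights T (p i) (τ (.inr i)) (q i) ∈ fragmentWeights := by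
    rw [← hres]
    exact (hψ.sumL.sigmaIn i).mem_fragmentWeights (H.decollineator i) (H.bipartite i)
  have hsum (i) : p i 0 + p i 1 + (q i 0 + q i 1) = τ (.inr i) := by
    rw [← hres]
    exact (hψ.sumL.sigmaIn i).sum_semiedges_221
  have hpq (i) (hi : finRotate H.k i ≠ s) : p (finRotate H.k i) = q i := by
    funext j
    have := hmate (.inl (i, .out j))
    simp only [severedJunctions, if_neg hi] at this
    exact this
  have hin (j) : p s j = φ (.inr (.inp j)) := hkeep (.inp j)
  have hout (j) : q ((finRotate H.k).symm s) j = φ (.inr (.out j)) := hkeep (.out j)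
  obtain ⟨⟨v, i, hv⟩, hne, c, ⟨-, hchain, hc⟩, rfl⟩ := H.inscribed.branch_induction s
    (fun e a b => weights T (p a) (τ e) (q b) ∈ fragmentWeights ++ chainWeights ∧
      (∀ v i, H.tree.opp e = .inl (v, i) → weights T (p a) (τ e) (q b) ∈ chainWeights) ∧
      p a 0 + p a 1 + (q b 0 + q b 1) = τ e)
    (fun e l he => by
      have : τ e = τ (.inr l) := by rw [← he, hτ.opp]
      rw [this]
      exact ⟨List.mem_append_left _ (hfrag l), fun v i hi => by simp [he] at hi, hsum l⟩)
    (fun e v i a b c he h1 hb h2 => by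
      have hline := (hτ.2.2 v).sum_eq_zero_and_weight
      have he' : τ e = τ (.inl (v, i)) := by rw [← he, hτ.opp]
      have hline' : τ e + τ (.inl (v, i + 1)) + τ (.inl (v, i + 1 + 1)) = 0 ∧
          T.weight (τ e) + T.weight (τ (.inl (v, i + 1))) +
            T.weight (τ (.inl (v, i + 1 + 1))) = 4 := by
        rw [he', ← hline.1]
        fin_cases i
        · exact ⟨rfl, hline.2⟩
        · exact ⟨by simp only [Fin.isValue, Fin.mk_one, Fin.reduceAdd]; abel,
            by simp only [Fin.isValue, Fin.mk_one, Fin.reduceAdd]; omega⟩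
        · exact ⟨by simp only [Fin.isValue, Fin.reduceFinMk, Fin.reduceAdd]; abel,
            by simp only [Fin.isValue, Fin.reduceFinMk, Fin.reduceAdd]; omega⟩
      have hs : p a 0 + p a 1 + (q c 0 + q c 1) = τ e := by
        have hx := h1.2.2
        have hy := h2.2.2
        rw [hpq b hb] at hy
        have hq := vec_add_self (q b 0 + q b 1)
        have hz := vec_add_self (τ e)
        linear_combination hx + hy + hline'.1 - hq - hz
      have hmem : weights T (p a) (τ e) (q c) ∈ chainWeights := by
        have h2' := h2.1
        rw [hpq b hb] at h2'
        refine mem_chainWeights h1.1 h2' hline'.2 ?_ ?_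
        · have := (hτ.2.1 e).weight_pos
          omega
        · rw [← hs]
          exact T.weightTriangle _ _
      exact ⟨List.mem_append_right _ hmem, fun _ _ _ => hmem, hs⟩)
  have hchain := hchain v i hv
  rw [Equiv.symm_apply_apply] at hout
  have hs := hsum (finRotate H.k c)
  have hfr := hfrag (finRotate H.k c)
  have hio : p (finRotate H.k c) 0 + p (finRotate H.k c) 1 = q c 0 + q c 1 := by
    rw [hpq _ hne, ← hs] at hc
    linear_combination -hc
  rw [hpq _ hne] at hchain
  unfold weights at hchain hfr
  rw [← hio] at hchain
  obtain ⟨h1, h2, h3⟩ := weights_of_fragment_chain hfr hchain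
  simp only [hin, hout] at h1 h2 h3 hio
  exact ⟨h1, h2, hio ▸ h1, h3⟩

end HalinData
end HalinSnarks

theorem theorem8p5 (T : HalinSnarks.Tetrahedron) (H : HalinSnarks.HalinData T) (s : Fin H.k) :
    (∀ P Q : Sym2 HalinSnarks.Vec, (H.extendedPole s).HasTransition T P Q →
      T.HasShape P HalinSnarks.Shape.ang ∧ T.HasShape Q HalinSnarks.Shape.ls) ∧
    ¬ ∃ P Q : Sym2 HalinSnarks.Vec,
      (H.extendedPole s).HasTransition T P Q ∧ T.Stationary P Q := by
  have key : ∀ P Q : Sym2 HalinSnarks.Vec, (H.extendedPole s).HasTransition T P Q →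
      T.HasShape P HalinSnarks.Shape.ang ∧ T.HasShape Q HalinSnarks.Shape.ls := by
    rintro P Q ⟨φ, hφ, rfl, rfl⟩
    obtain ⟨h1, h2, h3, h4⟩ := H.weights_of_isFlow_extendedPole s hφ
    exact ⟨HalinSnarks.Tetrahedron.hasShape_ang_of_weight (hφ.2.1 _) (hφ.2.1 _) h1 h2,
      HalinSnarks.Tetrahedron.hasShape_ls_of_weight (hφ.2.1 _) (hφ.2.1 _) h3 h4⟩
  refine ⟨key, ?_⟩
  rintro ⟨P, Q, hPQ, hst⟩
  obtain ⟨hP, hQ⟩ := key P Q hPQ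
  exact HalinSnarks.Tetrahedron.not_stationary_of_ang_ls hP hQ hst
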